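/- Let $\Gamma=(V,E,w)$ be a directed network: a directed graph, not necessarily finite, with loops and multiple edges allowed, in which every edge $e$ carries a weight $w(e)$. A walk $a\to b$ may repeat vertices and edges and may have length $0$; its weight $w(\pi)$ is the product of the weights of its edges. Let $W(a,b)=\sum_\pi w(\pi)$, the sum over all walks $\pi$ from $a$ to $b$. The weights are either independent formal variables, one for each edge (then $W(a,b)$ is a well-defined formal power series), or numbers. The loop-erased part $\mathrm{LE}(\pi)$ of a walk $\pi$ is the self-avoiding walk obtained from $\pi$ by repeatedly removing the first loop: if $\pi$ visits $v_0,v_1,\dots,v_m$ and these are not all distinct, take the smallest $j$ such that $v_j=v_i$ for some $i<j$, remove the segment of $\pi$ from $v_i$ to $v_j$, and repeat until all vertices are distinct. Let $a_1,\dots,a_k$ and $b_1,\dots,b_k$ be vertices of $\Gamma$ such that, whenever $i<i'$ and $j'<j$, every walk from $a_i$ to $b_j$ has a common vertex with every walk from $a_{i'}$ to $b_{j'}$. Let $W_{A,B}=(W(a_i,b_j))_{i,j=1}^k$. (1) For formal weights, $$\det(W_{A,B})=\sum w(\pi_1)\cdots w(\pi_k),$$ where the sum is over all families of walks $\pi_1:a_1\to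 b_1,\ \dots,\ \pi_k:a_k\to b_k$ such that for every $1\le i<k$ the walk $\pi_{i+1}$ has no common vertex with $\mathrm{LE}(\pi_i)$. The same identity, with an absolutely convergent right-hand side, holds for real or complex weights for which all the series $W(a_i,b_j)$, $1\le i,j\le k$, converge absolutely. (2) If all edge weights are nonnegative real numbers and all the series $W(a_i,b_j)$, $1\le i,j\le k$, converge, then the matrix $W_{A,B}$ is totally nonnegative, i.e. all its minors are nonnegative. -/

import Mathlib

open scoped MvPowerSeries.WithPiTopology

/-! Directed graphs, possibly with loops and multiple edges, are quivers; the type of all edges of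
`V` is `Quiver.Total V`, and a walk from `a` to `b` is a `Quiver.Path a b`, which may repeat
vertices and edges. -/

section LoopErasure

variable {V : Type*} [Quiver V]

open Classical in
/-- The initial segment of a walk up to its first visit to the vertex `v`. -/
noncomputable def Quiver.Path.upTo {a : V} (v : V) :
    ∀ {b : V} (p : Quiver.Path a b), v ∈ p.vertices → Quiver.Path a v
  | _, .nil, h => Quiver.Path.nil.cast rfl (List.mem_singleton.1 h).symm
  | _, .cons p e, h =>
    if h' : v ∈ p.vertices then p.upTo v h'
    else (p.cons e).cast rfl
      (((Quiver.Path.mem_vertices_cons p e).1 h).resolve_left h').symm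

open Classical in
/-- The loop-erased part `LE(p)` of a walk: follow the walk, and each time it returns to a vertex of
the self-avoiding walk built so far, remove the loop just closed. The three lemmas below show that
this is the operator determined by: `LE(p) = p` if `p` has no repeated vertex, and otherwise
`LE(p) = LE(p')` with `p'` obtained from `p` by removing the first loop. -/
noncomputable def Quiver.Path.loopErasure {a : V} :
    ∀ {b : V}, Quiver.Path a b → Quiver.Path a b
  | _, .nil => .nil
  | c, .cons p e =>
    if h : c ∈ p.loopErasure.vertices then p.loopErasure.upTo c h
    else p.loopErasure.cons e

theorem Quiver.Path.upTo_comp {a v b : V} (p : Quiver.Path a v) (q : Quiver.Path v b)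
    (hp : v ∉ p.vertices.dropLast) (h : v ∈ (p.comp q).vertices) :
    (p.comp q).upTo v h = p := by
  induction q with
  | nil =>
    cases p with
    | nil => rfl
    | cons p e =>
      have hv : v ∉ p.vertices := by simpa using hp
      simp only [Quiver.Path.comp_nil, Quiver.Path.upTo, hv, dite_false]
      rfl
  | cons q e ih =>
    have hv : v ∈ (p.comp q).vertices := by
      rw [Quiver.Path.vertices_comp]
      exact List.mem_append_right _ q.start_mem_vertices
    simp only [Quiver.Path.comp_cons, Quiver.Path.upTo, hv, dite_true]
    exact ih hv

/-- A walk without self-intersections is its own loop-erased part. -/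
theorem Quiver.Path.loopErasure_of_nodup {a b : V} (p : Quiver.Path a b)
    (hp : p.vertices.Nodup) : p.loopErasure = p := by
  induction p with
  | nil => rfl
  | @cons b c p e ih =>
    rw [Quiver.Path.vertices_cons, List.concat_eq_append, List.nodup_append] at hp
    have hc : c ∉ p.vertices := fun h => hp.2.2 c h c (by simp) rfl
    simp [Quiver.Path.loopErasure, ih hp.1, hc]

/-- Removing the first loop `l` of a walk `p l q` (the only repetition in the vertex sequence of
`p l` is its last vertex) does not change the loop-erased part. -/
theorem Quiver.Path.loopErasure_remove_first_loop {a v b : V} (p : Quiver.Path a v)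
    (l : Quiver.Path v v) (q : Quiver.Path v b) (hl : 0 < l.length)
    (h : (p.comp l).vertices.dropLast.Nodup) :
    (p.comp (l.comp q)).loopErasure = (p.comp q).loopErasure := by
  induction q with
  | nil =>
    cases l with
    | nil => simp at hl
    | cons l e =>
      have h' : (p.comp l).vertices.Nodup := by simpa using h
      have hpn : (p.vertices.dropLast ++ [v]).Nodup := by
        rw [Quiver.Path.vertices_comp] at h'
        rw [List.nodup_append] at h' ⊢
        refine ⟨h'.1, by simp, fun x hx y hy => h'.2.2 x hx y ?_⟩
        rw [List.mem_singleton.1 hy]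
        exact l.start_mem_vertices
      have hv : v ∉ p.vertices.dropLast := fun hm =>
        (List.nodup_append.1 hpn).2.2 v hm v (by simp) rfl
      have hm : v ∈ (p.comp l).vertices := by
        rw [Quiver.Path.vertices_comp]
        exact List.mem_append_right _ l.start_mem_vertices
      rw [Quiver.Path.dropLast_append_end_eq] at hpn
      simp only [Quiver.Path.comp_nil, Quiver.Path.comp_cons, Quiver.Path.loopErasure,
        Quiver.Path.loopErasure_of_nodup _ h', hm, dite_true,
        Quiver.Path.loopErasure_of_nodup _ hpn]
      exact Quiver.Path.upTo_comp p l hv hm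
  | cons q e ih =>
    simp only [Quiver.Path.comp_cons, Quiver.Path.loopErasure]
    generalize (p.comp (l.comp q)).loopErasure = x at ih
    subst ih
    rfl

theorem Quiver.Path.upTo_vertices_prefix {a b : V} (v : V) (p : Quiver.Path a b)
    (h : v ∈ p.vertices) : (p.upTo v h).vertices <+: p.vertices := by
  induction p with
  | nil =>
    obtain rfl := List.mem_singleton.1 h
    exact List.prefix_refl _
  | @cons b c p e ih =>
    by_cases hv : v ∈ p.vertices
    · simp only [Quiver.Path.upTo, hv, dite_true]
      exact (ih hv).trans (by simp)
    · obtain rfl : v = c := ((Quiver.Path.mem_vertices_cons p e).1 h).resolve_left hv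
      simp only [Quiver.Path.upTo, hv, dite_false]
      exact List.prefix_refl _

/-- Loop-erased parts are self-avoiding. -/
theorem Quiver.Path.loopErasure_nodup {a b : V} (p : Quiver.Path a b) :
    p.loopErasure.vertices.Nodup := by
  induction p with
  | nil => simp [Quiver.Path.loopErasure]
  | @cons b c p e ih =>
    by_cases hc : c ∈ p.loopErasure.vertices
    · simp only [Quiver.Path.loopErasure, hc, dite_true]
      exact (Quiver.Path.upTo_vertices_prefix c _ hc).sublist.nodup ih
    · simp only [Quiver.Path.loopErasure, hc, dite_false, Quiver.Path.vertices_cons,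
        List.concat_eq_append, List.nodup_append]
      refine ⟨ih, by simp, fun x hx y hy hxy => hc ?_⟩
      rw [← List.mem_singleton.1 hy, ← hxy]
      exact hx

end LoopErasure

/-- The weight of a walk: the product of the weights of its edges. -/
def walkWeight {V : Type*} [Quiver V] {R : Type*} [Monoid R] (w : Quiver.Total V → R)
    {a b : V} (p : Quiver.Path a b) : R :=
  Quiver.Path.weight (fun {i j} (e : i ⟶ j) => w ⟨i, j, e⟩) p

/-- The entry `W(a, b)` of the walk matrix: the sum of the weights of all walks from `a` to `b`. -/
noncomputable def walkSum {V : Type*} [Quiver V] {R : Type*} [CommRing R] [TopologicalSpace R]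
    (w : Quiver.Total V → R) (a b : V) : R :=
  ∑' p : Quiver.Path a b, walkWeight w p

/-- The matrix `W_{A,B} = (W(a_i, b_j))`. -/
noncomputable def walkMatrix {V : Type*} [Quiver V] {R : Type*} [CommRing R] [TopologicalSpace R]
    (w : Quiver.Total V → R) {k : ℕ} (a b : Fin k → V) : Matrix (Fin k) (Fin k) R :=
  Matrix.of fun i j => walkSum w (a i) (b j)

/-- The weights taken to be independent formal variables, one for each edge. Power series carry the
topology of coefficientwise convergence, with `ℤ` discrete. -/
noncomputable def formalWeight (V : Type*) [Quiver V] (e : Quiver.Total V) :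
    MvPowerSeries (Quiver.Total V) ℤ :=
  MvPowerSeries.X e

/-- Families of walks `π_i : a_i → b_i` such that `π_{i+1}` has no common vertex with the
loop-erased part of `π_i`, for each `i`. -/
def LoopErasedFamily {V : Type*} [Quiver V] {k : ℕ} (a b : Fin k → V) : Type _ :=
  {π : ∀ i, Quiver.Path (a i) (b i) //
    ∀ i j : Fin k, (i : ℕ) + 1 = j →
      ∀ v, v ∈ (π j).vertices → v ∉ (π i).loopErasure.vertices}

/-- A matrix is totally nonnegative if all its minors are nonnegative. -/
def Matrix.IsTotallyNonneg {m n : ℕ} (M : Matrix (Fin m) (Fin n) ℝ) : Prop :=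
  ∀ (r : ℕ) (I : Fin r ↪o Fin m) (J : Fin r ↪o Fin n), 0 ≤ (M.submatrix I J).det

/-!
Expanding the determinant and the products of sums in it gives
`det W_{A,B} = ∑ sign σ * ∏ w(π i)`, summed over all permutations `σ` and all families of walks
`π i : a i → b (σ i)` (`hasSum_signedWeight`). A family has a crossing if some walk `π j` meets the
loop-erased part of an earlier walk `π i`. Families with a crossing cancel in pairs: let `i` be
minimal such that `LE(π i)` meets a later walk, `v` the first vertex of `LE(π i)` where this
happens, and `j` minimal among the later walks through `v`; cut `π i` and `π j` at their *last* visits to `v`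
and exchange the ends (`PermutedFamily.exchange`). This keeps the weight and composes `σ` with a
transposition. It is an involution because it leaves the first crossing `(i, j, v)` in place
(`IsFirstCrossing.exchange`): after its last visit to `v`, the walk `π i` avoids the part of
`LE(π i)` before `v` (`Quiver.Path.notMem_loopErasure_of_mem_loopErasure_comp`), and `π j` avoids it
by the choice of `v`. So the initial segment of `LE(π i)` up to `v` survives
(`Quiver.Path.loopErasure_prefix_comp`), and before `v` it still meets no later walk.

In a family without crossings, an inversion of `σ` would give two walks which have to meet, so
`σ = 1` (`ForcesCrossing.perm_eq_one`). Moreover, if consecutive walks do not cross, then no two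
walks do (`ForcesCrossing.not_hasCrossing`): if `π j` met `LE(π i)`, where `i + 1 < j`, then one
could walk from `a i` along `LE(π i)` and on along `π j` to `b j` without meeting `LE(π (i + 1))`. The
remaining families are therefore exactly those of the theorem.

Rearrangement is justified by absolute convergence for numerical weights, and for formal weights by
the nonarchimedean topology on power series, in which a walk is determined up to finitely many
choices by its weight. The minors of a nonnegative walk matrix are again determinants of this kind,
since the hypothesis passes to subfamilies of the vertices, and are thus sums of nonnegative terms.
-/

/-! ### Walks cut at a vertex -/

section Walks

variable {V : Type*} [Quiver V]

/-- If the last vertex of a prefix `l` of a list without repetitions occurs in another prefix, then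
that prefix contains `l`. -/
theorem List.IsPrefix.prefix_of_getLast_mem {α : Type*} {l m L : List α} (hl : l <+: L)
    (hm : m <+: L) (hL : L.Nodup) (h : l ≠ []) (hmem : l.getLast h ∈ m) : l <+: m := by
  rcases List.prefix_or_prefix_of_prefix hl hm with h' | ⟨t, rfl⟩
  · exact h'
  · rcases List.eq_nil_or_concat t with rfl | ⟨t, x, rfl⟩
    · simp
    · have := hl.sublist.nodup hL
      exfalso
      grind [List.nodup_append]

theorem Quiver.Path.tail_vertices_cons {a b c : V} (p : Quiver.Path a b) (e : b ⟶ c) :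
    (p.cons e).vertices.tail = p.vertices.tail ++ [c] := by
  rw [Quiver.Path.vertices_cons, List.concat_eq_append,
    List.tail_append_of_ne_nil p.vertices_ne_nil]

/-- A walk through `v` can be cut at its last visit to `v` in one way only. -/
theorem Quiver.Path.eq_and_eq_of_comp_eq_comp {a v b : V} {p p' : Quiver.Path a v}
    {q q' : Quiver.Path v b} (h : p.comp q = p'.comp q') (hq : v ∉ q.vertices.tail)
    (hq' : v ∉ q'.vertices.tail) : p = p' ∧ q = q' := by
  induction q with
  | nil =>
    cases q' with
    | nil => exact ⟨h, rfl⟩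
    | cons q' e =>
      rw [Quiver.Path.tail_vertices_cons] at hq'
      simp at hq'
  | cons q e ih =>
    cases q' with
    | nil =>
      rw [Quiver.Path.tail_vertices_cons] at hq
      simp at hq
    | cons q' e' =>
      simp only [Quiver.Path.comp_cons, Quiver.Path.cons.injEq] at h
      obtain ⟨rfl, h1, h2⟩ := h
      rw [Quiver.Path.tail_vertices_cons] at hq hq'
      obtain ⟨rfl, rfl⟩ := ih (eq_of_heq h1) (fun h => hq (by simp [h]))
        (fun h => hq' (by simp [h]))
      exact ⟨rfl, by rw [eq_of_heq h2]⟩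

/-- The part of a walk up to its last visit to `v`. -/
noncomputable def Quiver.Path.beforeLast {a b : V} (v : V) (p : Quiver.Path a b)
    (h : v ∈ p.vertices) : Quiver.Path a v :=
  (p.exists_eq_comp_and_notMem_tail_of_mem_vertices h).choose

/-- The part of a walk from its last visit to `v` on. -/
noncomputable def Quiver.Path.afterLast {a b : V} (v : V) (p : Quiver.Path a b)
    (h : v ∈ p.vertices) : Quiver.Path v b :=
  (p.exists_eq_comp_and_notMem_tail_of_mem_vertices h).choose_spec.choose

theorem Quiver.Path.beforeLast_comp_afterLast {a b : V} {v : V} (p : Quiver.Path a b)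
    (h : v ∈ p.vertices) : (p.beforeLast v h).comp (p.afterLast v h) = p :=
  (p.exists_eq_comp_and_notMem_tail_of_mem_vertices h).choose_spec.choose_spec.1.symm

theorem Quiver.Path.notMem_tail_afterLast {a b : V} {v : V} (p : Quiver.Path a b)
    (h : v ∈ p.vertices) : v ∉ (p.afterLast v h).vertices.tail :=
  (p.exists_eq_comp_and_notMem_tail_of_mem_vertices h).choose_spec.choose_spec.2

theorem Quiver.Path.mem_vertices_comp {a b c : V} (p : Quiver.Path a b) (q : Quiver.Path b c)
    (u : V) : u ∈ (p.comp q).vertices ↔ u ∈ p.vertices ∨ u ∈ q.vertices := by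
  rw [Quiver.Path.vertices_comp, ← p.dropLast_append_end_eq]
  have := q.start_mem_vertices
  grind

theorem Quiver.Path.vertices_eq_cons_tail {a b : V} (p : Quiver.Path a b) :
    p.vertices = a :: p.vertices.tail := by
  have := p.vertices_head?
  cases h : p.vertices <;> simp_all

theorem Quiver.Path.vertices_cast_right {a b c : V} (p : Quiver.Path a b) (h : b = c) :
    (p.cast rfl h).vertices = p.vertices := by
  subst h
  rfl

theorem Quiver.Path.loopErasure_cast_right {a b c : V} (p : Quiver.Path a b) (h : b = c) :
    (p.cast rfl h).loopErasure = p.loopErasure.cast rfl h := by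
  subst h
  rfl

/-! ### The loop-erased part of a concatenation -/

theorem Quiver.Path.loopErasure_vertices_subset {a b : V} (p : Quiver.Path a b) :
    p.loopErasure.vertices ⊆ p.vertices := by
  induction p with
  | nil => simp [Quiver.Path.loopErasure]
  | @cons b c p e ih =>
    intro u hu
    rw [Quiver.Path.mem_vertices_cons]
    by_cases hc : c ∈ p.loopErasure.vertices
    · simp only [Quiver.Path.loopErasure, hc, dite_true] at hu
      exact Or.inl (ih ((Quiver.Path.upTo_vertices_prefix c _ hc).subset hu))
    · simp only [Quiver.Path.loopErasure, hc, dite_false, Quiver.Path.mem_vertices_cons] at hu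
      exact hu.imp (fun h => ih h) id

/-- A continuation that avoids the loop-erased part built so far leaves it in place. -/
theorem Quiver.Path.loopErasure_prefix_comp {a v b : V} (p : Quiver.Path a v)
    (q : Quiver.Path v b) (h : ∀ u ∈ q.vertices.tail, u ∉ p.loopErasure.vertices) :
    p.loopErasure.vertices <+: (p.comp q).loopErasure.vertices := by
  induction q with
  | nil => simp
  | @cons c d q e ih =>
    rw [Quiver.Path.tail_vertices_cons] at h
    have ih := ih fun u hu => h u (by simp [hu])
    have hd := h d (by simp)
    by_cases hc : d ∈ (p.comp q).loopErasure.vertices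
    · simp only [Quiver.Path.comp_cons, Quiver.Path.loopErasure, hc, dite_true]
      have hpre := Quiver.Path.upTo_vertices_prefix d _ hc
      rcases List.prefix_or_prefix_of_prefix ih hpre with h' | h'
      · exact h'
      · exact absurd (h'.subset (Quiver.Path.end_mem_vertices _)) hd
    · simp only [Quiver.Path.comp_cons, Quiver.Path.loopErasure, hc, dite_false,
        Quiver.Path.vertices_cons, List.concat_eq_append]
      exact ih.trans (List.prefix_append _ _)

/-- If `v` survives in the loop-erased part, then after its last visit to `v` the walk avoids the
loop-erased part of what precedes: a visit to one of its vertices would close a loop through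
`v`. -/
theorem Quiver.Path.notMem_loopErasure_of_mem_loopErasure_comp {a v b : V} (p : Quiver.Path a v)
    (q : Quiver.Path v b) (hq : v ∉ q.vertices.tail) (hv : v ∈ (p.comp q).loopErasure.vertices) :
    ∀ u ∈ q.vertices.tail, u ∉ p.loopErasure.vertices := by
  induction q with
  | nil => simp
  | @cons c d q e ih =>
    rw [Quiver.Path.tail_vertices_cons] at hq ⊢
    have hvd : v ≠ d := fun h => hq (by simp [h])
    have hq' : v ∉ q.vertices.tail := fun h => hq (by simp [h])
    suffices h : v ∈ (p.comp q).loopErasure.vertices ∧ d ∉ p.loopErasure.vertices by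
      intro u hu
      rcases List.mem_append.1 hu with hu | hu
      · exact ih hq' h.1 u hu
      · rw [List.mem_singleton.1 hu]
        exact h.2
    by_cases hc : d ∈ (p.comp q).loopErasure.vertices
    · simp only [Quiver.Path.comp_cons, Quiver.Path.loopErasure, hc, dite_true] at hv
      have hpre := Quiver.Path.upTo_vertices_prefix d _ hc
      refine ⟨hpre.subset hv, fun hd => hvd ?_⟩
      have hp := p.loopErasure_prefix_comp q (ih hq' (hpre.subset hv))
      have hnd := (p.comp q).loopErasure_nodup
      -- Each of `v` and `d` is the last vertex of one of two prefixes that contain each other.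
      have h1 := hp.prefix_of_getLast_mem hpre hnd (Quiver.Path.vertices_ne_nil _)
        (by simpa using hv)
      have h2 := hpre.prefix_of_getLast_mem hp hnd (Quiver.Path.vertices_ne_nil _)
        (by simpa using hd)
      have h3 := h1.eq_of_length_le h2.length_le
      have h4 := p.loopErasure.vertices_getLast
      simp only [h3, Quiver.Path.vertices_getLast] at h4
      exact h4.symm
    · simp only [Quiver.Path.comp_cons, Quiver.Path.loopErasure, hc, dite_false,
        Quiver.Path.mem_vertices_cons, hvd, or_false] at hv
      exact ⟨hv, fun hd => hc ((p.loopErasure_prefix_comp q (ih hq' hv)).subset hd)⟩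

end Walks

/-! ### Exchanging the ends of two walks -/

section Exchange

variable {V : Type*} [Quiver V]

open Classical in
/-- The walk that follows `P` up to its last visit to `v` and then `Q` from its last visit to `v`
on; it is `P` itself if `P` and `Q` do not both visit `v`. Walks are bundled with their last
vertex, which the operation changes. -/
noncomputable def exchangeEnd (v : V) {x y : V} (P : Σ z, Quiver.Path x z)
    (Q : Σ z, Quiver.Path y z) : Σ z, Quiver.Path x z :=
  if h : v ∈ P.2.vertices ∧ v ∈ Q.2.vertices then
    ⟨Q.1, (P.2.beforeLast v h.1).comp (Q.2.afterLast v h.2)⟩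
  else P

theorem exchangeEnd_comp {v x y c d : V} {p : Quiver.Path x v} {p' : Quiver.Path v c}
    {q : Quiver.Path y v} {q' : Quiver.Path v d} (hp : v ∉ p'.vertices.tail)
    (hq : v ∉ q'.vertices.tail) :
    exchangeEnd v ⟨c, p.comp p'⟩ ⟨d, q.comp q'⟩ = ⟨d, p.comp q'⟩ := by
  have hP : v ∈ (p.comp p').vertices :=
    (Quiver.Path.mem_vertices_comp _ _ _).2 (Or.inl p.end_mem_vertices)
  have hQ : v ∈ (q.comp q').vertices :=
    (Quiver.Path.mem_vertices_comp _ _ _).2 (Or.inl q.end_mem_vertices)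
  rw [exchangeEnd, dif_pos ⟨hP, hQ⟩,
    (Quiver.Path.eq_and_eq_of_comp_eq_comp ((p.comp p').beforeLast_comp_afterLast hP)
      (Quiver.Path.notMem_tail_afterLast _ _) hp).1,
    (Quiver.Path.eq_and_eq_of_comp_eq_comp ((q.comp q').beforeLast_comp_afterLast hQ)
      (Quiver.Path.notMem_tail_afterLast _ _) hq).2]

theorem exchangeEnd_self (v : V) {x : V} (P : Σ z, Quiver.Path x z) : exchangeEnd v P P = P := by
  by_cases h : v ∈ P.2.vertices
  · rw [exchangeEnd, dif_pos ⟨h, h⟩, Quiver.Path.beforeLast_comp_afterLast]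
  · simp [exchangeEnd, h]

theorem mem_or_mem_of_mem_exchangeEnd {v x y : V} {P : Σ z, Quiver.Path x z}
    {Q : Σ z, Quiver.Path y z} {u : V} (h : u ∈ (exchangeEnd v P Q).2.vertices) :
    u ∈ P.2.vertices ∨ u ∈ Q.2.vertices := by
  by_cases hv : v ∈ P.2.vertices ∧ v ∈ Q.2.vertices
  · obtain ⟨c, P⟩ := P
    obtain ⟨d, Q⟩ := Q
    obtain ⟨p, p', rfl, hp⟩ := P.exists_eq_comp_and_notMem_tail_of_mem_vertices hv.1
    obtain ⟨q, q', rfl, hq⟩ := Q.exists_eq_comp_and_notMem_tail_of_mem_vertices hv.2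
    rw [exchangeEnd_comp hp hq] at h
    simp only [Quiver.Path.mem_vertices_comp] at h ⊢
    tauto
  · rw [exchangeEnd, dif_neg hv] at h
    exact Or.inl h

section Mem

variable {v x y : V} {P : Σ z, Quiver.Path x z} {Q : Σ z, Quiver.Path y z}
  (hP : v ∈ P.2.vertices) (hQ : v ∈ Q.2.vertices)
include hP hQ

theorem mem_exchangeEnd : v ∈ (exchangeEnd v P Q).2.vertices := by
  rw [exchangeEnd, dif_pos ⟨hP, hQ⟩]
  exact (Quiver.Path.mem_vertices_comp _ _ _).2 (Or.inl (Quiver.Path.end_mem_vertices _))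

theorem exchangeEnd_fst : (exchangeEnd v P Q).1 = Q.1 := by
  rw [exchangeEnd, dif_pos ⟨hP, hQ⟩]

theorem exchangeEnd_exchangeEnd :
    exchangeEnd v (exchangeEnd v P Q) (exchangeEnd v Q P) = P := by
  obtain ⟨c, P⟩ := P
  obtain ⟨d, Q⟩ := Q
  obtain ⟨p, p', rfl, hp⟩ := P.exists_eq_comp_and_notMem_tail_of_mem_vertices hP
  obtain ⟨q, q', rfl, hq⟩ := Q.exists_eq_comp_and_notMem_tail_of_mem_vertices hQ
  rw [exchangeEnd_comp hp hq, exchangeEnd_comp hq hp, exchangeEnd_comp hq hp]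

theorem walkWeight_exchangeEnd_mul {R : Type*} [CommMonoid R] (w : Quiver.Total V → R) :
    walkWeight w (exchangeEnd v P Q).2 * walkWeight w (exchangeEnd v Q P).2 =
      walkWeight w P.2 * walkWeight w Q.2 := by
  obtain ⟨c, P⟩ := P
  obtain ⟨d, Q⟩ := Q
  obtain ⟨p, p', rfl, hp⟩ := P.exists_eq_comp_and_notMem_tail_of_mem_vertices hP
  obtain ⟨q, q', rfl, hq⟩ := Q.exists_eq_comp_and_notMem_tail_of_mem_vertices hQ
  rw [exchangeEnd_comp hp hq, exchangeEnd_comp hq hp]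
  simp only [walkWeight, Quiver.Path.weight_comp]
  exact mul_mul_mul_comm _ _ _ _ |>.trans (by
    rw [mul_comm (Quiver.Path.weight _ q'), mul_mul_mul_comm])

/-- Let `v` be the first vertex of the loop-erased part of `P` at which it meets `Q`. Then
exchanging the ends of `P` and `Q` at `v` preserves the loop-erased part of `P` up to `v`, and the
part of it before `v` still avoids the other walk. -/
theorem exists_loopErasure_exchangeEnd {l r : List V}
    (hl : P.2.loopErasure.vertices = l ++ v :: r) (hlQ : ∀ u ∈ l, u ∉ Q.2.vertices) :
    (∃ r', (exchangeEnd v P Q).2.loopErasure.vertices = l ++ v :: r') ∧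
      ∀ u ∈ l, u ∉ (exchangeEnd v Q P).2.vertices := by
  obtain ⟨c, P⟩ := P
  obtain ⟨d, Q⟩ := Q
  obtain ⟨p, p', rfl, hp⟩ := P.exists_eq_comp_and_notMem_tail_of_mem_vertices hP
  obtain ⟨q, q', rfl, hq⟩ := Q.exists_eq_comp_and_notMem_tail_of_mem_vertices hQ
  rw [exchangeEnd_comp hp hq, exchangeEnd_comp hq hp]
  dsimp only at hl hlQ ⊢
  have hav := p.notMem_loopErasure_of_mem_loopErasure_comp p' hp (by simp [hl])
  have hpre := p.loopErasure_prefix_comp p' hav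
  have hnd := (p.comp p').loopErasure_nodup
  -- The loop-erased part of the walk up to the cut is the initial segment `l ++ [v]`.
  have hlv : p.loopErasure.vertices = l ++ [v] := by
    have hl' : l ++ [v] <+: (p.comp p').loopErasure.vertices := by simp [hl]
    refine (hpre.prefix_of_getLast_mem hl' hnd (Quiver.Path.vertices_ne_nil _)
      (by simp)).eq_of_length_le (List.IsPrefix.length_le ?_)
    exact hl'.prefix_of_getLast_mem hpre hnd (by simp) (by simp)
  have hvl : v ∉ l := by
    rw [hl] at hnd
    grind [List.nodup_append]
  constructor
  · obtain ⟨t, ht⟩ := p.loopErasure_prefix_comp q' (fun u hu => by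
      rw [hlv]
      intro h
      rcases List.mem_append.1 h with h | h
      · exact hlQ u h ((Quiver.Path.mem_vertices_comp _ _ _).2 (Or.inr (List.mem_of_mem_tail hu)))
      · rw [List.mem_singleton.1 h] at hu
        exact hq hu)
    exact ⟨t, by rw [← ht, hlv]; simp⟩
  · intro u hu h
    rcases (Quiver.Path.mem_vertices_comp _ _ _).1 h with h | h
    · exact hlQ u hu ((Quiver.Path.mem_vertices_comp _ _ _).2 (Or.inl h))
    · rw [p'.vertices_eq_cons_tail] at h
      rcases List.mem_cons.1 h with rfl | h
      · exact hvl hu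
      · exact hav u h (by simp [hlv, hu])

end Mem

end Exchange

/-! ### The first crossing of a family of walks -/

section Crossing

variable {V : Type*} [Quiver V] {k : ℕ} {a : Fin k → V}

/-- Some walk of the family meets the loop-erased part of an earlier one. -/
def HasCrossing (π : ∀ i, Σ z, Quiver.Path (a i) z) : Prop :=
  ∃ i j, i < j ∧ ∃ v ∈ (π i).2.loopErasure.vertices, v ∈ (π j).2.vertices

/-- The crossing at which ends are exchanged: `i` is the first index such that the loop-erased part
of the `i`-th walk meets a later walk, `v` is the first vertex of this loop-erased part on a later
walk, and `j` is the first index after `i` of a walk through `v`. -/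
structure IsFirstCrossing (π : ∀ i, Σ z, Quiver.Path (a i) z) (i j : Fin k) (v : V) : Prop where
  lt : i < j
  avoid : ∀ i' < i, ∀ m > i', ∀ u ∈ (π i').2.loopErasure.vertices, u ∉ (π m).2.vertices
  first : ∃ l r, (π i).2.loopErasure.vertices = l ++ v :: r ∧
    ∀ m > i, ∀ u ∈ l, u ∉ (π m).2.vertices
  mem : v ∈ (π j).2.vertices
  between : ∀ m, i < m → m < j → v ∉ (π m).2.vertices

theorem HasCrossing.exists_isFirstCrossing {π : ∀ i, Σ z, Quiver.Path (a i) z}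
    (h : HasCrossing π) : ∃ i j v, IsFirstCrossing π i j v := by
  classical
  obtain ⟨i, ⟨j₀, hij₀, u, hu, huj⟩, hi⟩ := WellFounded.has_min (wellFounded_lt (α := Fin k))
    {i | ∃ j, i < j ∧ ∃ v ∈ (π i).2.loopErasure.vertices, v ∈ (π j).2.vertices} h
  obtain ⟨v, hv⟩ : ∃ v, (π i).2.loopErasure.vertices.find?
      (fun u => ∃ m > i, u ∈ (π m).2.vertices) = some v := by
    rw [← Option.isSome_iff_exists, List.find?_isSome]
    exact ⟨u, hu, by simpa using ⟨j₀, hij₀, huj⟩⟩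
  obtain ⟨hvm, l, r, hl, hlm⟩ := List.find?_eq_some_iff_append.1 hv
  obtain ⟨j, ⟨hij, hvj⟩, hj⟩ := WellFounded.has_min (wellFounded_lt (α := Fin k))
    {m | i < m ∧ v ∈ (π m).2.vertices} (by simpa [Set.Nonempty] using hvm)
  refine ⟨i, j, v, hij, fun i' hi' m hm u hu hum => hi i' ⟨m, hm, u, hu, hum⟩ hi',
    ⟨l, r, hl, fun m hm u hu hum => ?_⟩, hvj, fun m him hmj hvm => hj m ⟨him, hvm⟩ hmj⟩
  have := hlm u hu
  simp only [Bool.not_eq_true', decide_eq_false_iff_not] at this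
  exact this ⟨m, hm, hum⟩

namespace IsFirstCrossing

variable {π : ∀ i, Σ z, Quiver.Path (a i) z} {i j i' j' : Fin k} {v v' : V}

theorem mem_loopErasure (h : IsFirstCrossing π i j v) :
    v ∈ (π i).2.loopErasure.vertices := by
  obtain ⟨l, r, hl, -⟩ := h.first
  simp [hl]

theorem mem_left (h : IsFirstCrossing π i j v) : v ∈ (π i).2.vertices :=
  Quiver.Path.loopErasure_vertices_subset _ h.mem_loopErasure

theorem hasCrossing (h : IsFirstCrossing π i j v) : HasCrossing π :=
  ⟨i, j, h.lt, v, h.mem_loopErasure, h.mem⟩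

theorem unique (h : IsFirstCrossing π i j v) (h' : IsFirstCrossing π i' j' v') :
    i = i' ∧ j = j' ∧ v = v' := by
  obtain rfl : i = i' := by
    rcases lt_trichotomy i i' with hi | hi | hi
    · exact absurd h.mem (h'.avoid i hi j h.lt v h.mem_loopErasure)
    · exact hi
    · exact absurd h'.mem (h.avoid i' hi j' h'.lt v' h'.mem_loopErasure)
  obtain rfl : v = v' := by
    obtain ⟨l, r, hl, hlm⟩ := h.first
    obtain ⟨l', r', hl', hlm'⟩ := h'.first
    have h1 : v ∉ l' := fun hv => hlm' j h.lt v hv h.mem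
    have h2 : v' ∉ l := fun hv => hlm j' h'.lt v' hv h'.mem
    rw [hl, List.append_eq_append_iff] at hl'
    rcases hl' with ⟨t, ht, ht'⟩ | ⟨t, ht, ht'⟩
    · cases t <;> simp_all
    · cases t <;> simp_all
  refine ⟨rfl, ?_, rfl⟩
  rcases lt_trichotomy j j' with hj | hj | hj
  · exact absurd h.mem (h'.between j h.lt hj)
  · exact hj
  · exact absurd h'.mem (h.between j' h'.lt hj)

end IsFirstCrossing

/-- Exchange the ends of the `i`-th and the `j`-th walk of a family at `v`. -/
noncomputable def exchangeFamily (i j : Fin k) (v : V) (π : ∀ i, Σ z, Quiver.Path (a i) z) :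
    ∀ i, Σ z, Quiver.Path (a i) z :=
  fun m => exchangeEnd v (π m) (π (Equiv.swap i j m))

theorem exchangeFamily_of_ne {i j m : Fin k} (v : V) (π : ∀ i, Σ z, Quiver.Path (a i) z)
    (hi : m ≠ i) (hj : m ≠ j) : exchangeFamily i j v π m = π m := by
  rw [exchangeFamily, Equiv.swap_apply_of_ne_of_ne hi hj, exchangeEnd_self]

theorem exchangeFamily_left (i j : Fin k) (v : V) (π : ∀ i, Σ z, Quiver.Path (a i) z) :
    exchangeFamily i j v π i = exchangeEnd v (π i) (π j) := by
  rw [exchangeFamily, Equiv.swap_apply_left]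

theorem exchangeFamily_right (i j : Fin k) (v : V) (π : ∀ i, Σ z, Quiver.Path (a i) z) :
    exchangeFamily i j v π j = exchangeEnd v (π j) (π i) := by
  rw [exchangeFamily, Equiv.swap_apply_right]

namespace IsFirstCrossing

variable {π : ∀ i, Σ z, Quiver.Path (a i) z} {i j : Fin k} {v : V} (h : IsFirstCrossing π i j v)
include h

theorem exchangeFamily_exchangeFamily :
    exchangeFamily i j v (exchangeFamily i j v π) = π := by
  funext m
  by_cases hi : m = i
  · subst hi
    rw [exchangeFamily_left, exchangeFamily_left, exchangeFamily_right,
      exchangeEnd_exchangeEnd h.mem_left h.mem]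
  by_cases hj : m = j
  · subst hj
    rw [exchangeFamily_right, exchangeFamily_left, exchangeFamily_right,
      exchangeEnd_exchangeEnd h.mem h.mem_left]
  rw [exchangeFamily_of_ne _ _ hi hj, exchangeFamily_of_ne _ _ hi hj]

theorem exchangeFamily_fst (m : Fin k) :
    (exchangeFamily i j v π m).1 = (π (Equiv.swap i j m)).1 := by
  by_cases hi : m = i
  · subst hi
    rw [exchangeFamily_left, exchangeEnd_fst h.mem_left h.mem, Equiv.swap_apply_left]
  by_cases hj : m = j
  · subst hj
    rw [exchangeFamily_right, exchangeEnd_fst h.mem h.mem_left, Equiv.swap_apply_right]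
  rw [exchangeFamily_of_ne _ _ hi hj, Equiv.swap_apply_of_ne_of_ne hi hj]

theorem prod_walkWeight_exchangeFamily {R : Type*} [CommMonoid R] (w : Quiver.Total V → R) :
    ∏ m, walkWeight w (exchangeFamily i j v π m).2 = ∏ m, walkWeight w (π m).2 := by
  have hj : j ∈ Finset.univ.erase i := by simp [h.lt.ne']
  rw [← Finset.mul_prod_erase _ _ (Finset.mem_univ i), ← Finset.mul_prod_erase _ _ hj,
    ← Finset.mul_prod_erase _ (fun m => walkWeight w (π m).2) (Finset.mem_univ i),
    ← Finset.mul_prod_erase _ (fun m => walkWeight w (π m).2) hj, ← mul_assoc, ← mul_assoc,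
    exchangeFamily_left, exchangeFamily_right, walkWeight_exchangeEnd_mul h.mem_left h.mem]
  congr 1
  refine Finset.prod_congr rfl fun m hm => ?_
  rw [exchangeFamily_of_ne v π (by grind) (by grind)]

/-- The exchange does not change the first crossing, so that it can be undone. -/
theorem exchange : IsFirstCrossing (exchangeFamily i j v π) i j v := by
  have hne {m : Fin k} (hi : m ≠ i) (hj : m ≠ j) := exchangeFamily_of_ne v π hi hj
  obtain ⟨l, r, hl, hlm⟩ := h.first
  obtain ⟨⟨r', hr'⟩, hlj⟩ :=
    exists_loopErasure_exchangeEnd h.mem_left h.mem hl (hlm j h.lt)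
  refine ⟨h.lt, fun i' hi' m hm u hu hum => ?_, ⟨l, r', ?_, fun m hm u hu hum => ?_⟩, ?_,
    fun m him hmj => ?_⟩
  · rw [hne hi'.ne (hi'.trans h.lt).ne] at hu
    rcases mem_or_mem_of_mem_exchangeEnd hum with hum | hum
    · exact h.avoid i' hi' m hm u hu hum
    · refine h.avoid i' hi' _ ?_ u hu hum
      rw [Equiv.swap_apply_def]
      split_ifs
      · exact hi'.trans h.lt
      · exact hi'
      · exact hm
  · rw [exchangeFamily_left, hr']
  · by_cases hj : m = j
    · subst hj
      rw [exchangeFamily_right] at hum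
      exact hlj u hu hum
    · rw [hne hm.ne' hj] at hum
      exact hlm m hm u hu hum
  · rw [exchangeFamily_right]
    exact mem_exchangeEnd h.mem h.mem_left
  · rw [hne him.ne' hmj.ne]
    exact h.between m him hmj

end IsFirstCrossing

/-! ### Families ending at a permutation of given vertices -/

variable (a) in
/-- A permutation `σ` together with a family of walks `a i → b (σ i)`. -/
@[ext]
structure PermutedFamily (b : Fin k → V) where
  /-- the permutation `σ` -/
  perm : Equiv.Perm (Fin k)
  /-- the walks, bundled with their last vertices -/
  walks : ∀ i, Σ z, Quiver.Path (a i) z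
  end_eq : ∀ i, (walks i).1 = b (perm i)

variable {b : Fin k → V}

open Classical in
/-- Exchange the ends of the two walks at the first crossing, if there is a crossing. -/
noncomputable def PermutedFamily.exchange (x : PermutedFamily a b) : PermutedFamily a b :=
  if h : ∃ c : Fin k × Fin k × V, IsFirstCrossing x.walks c.1 c.2.1 c.2.2 then
    { perm := x.perm * Equiv.swap h.choose.1 h.choose.2.1
      walks := exchangeFamily h.choose.1 h.choose.2.1 h.choose.2.2 x.walks
      end_eq := fun m => by
        rw [h.choose_spec.exchangeFamily_fst, x.end_eq]
        rfl }
  else x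

theorem PermutedFamily.exchange_of_isFirstCrossing {x : PermutedFamily a b} {i j : Fin k} {v : V}
    (h : IsFirstCrossing x.walks i j v) :
    x.exchange.perm = x.perm * Equiv.swap i j ∧
      x.exchange.walks = exchangeFamily i j v x.walks := by
  have h' : ∃ c : Fin k × Fin k × V, IsFirstCrossing x.walks c.1 c.2.1 c.2.2 := ⟨(i, j, v), h⟩
  obtain ⟨h1, h2, h3⟩ := h'.choose_spec.unique h
  rw [exchange, dif_pos h', ← h1, ← h2, ← h3]
  exact ⟨rfl, rfl⟩

theorem PermutedFamily.exchange_of_not_hasCrossing {x : PermutedFamily a b}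
    (h : ¬ HasCrossing x.walks) : x.exchange = x :=
  dif_neg fun ⟨_, h'⟩ => h h'.hasCrossing

theorem PermutedFamily.hasCrossing_exchange_iff (x : PermutedFamily a b) :
    HasCrossing x.exchange.walks ↔ HasCrossing x.walks := by
  by_cases h : HasCrossing x.walks
  · obtain ⟨i, j, v, h'⟩ := h.exists_isFirstCrossing
    rw [(exchange_of_isFirstCrossing h').2]
    exact iff_of_true h'.exchange.hasCrossing h
  · rw [exchange_of_not_hasCrossing h]

theorem PermutedFamily.exchange_involutive :
    Function.Involutive (PermutedFamily.exchange (a := a) (b := b)) := by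
  intro x
  by_cases h : HasCrossing x.walks
  · obtain ⟨i, j, v, h⟩ := h.exists_isFirstCrossing
    obtain ⟨h1, h2⟩ := exchange_of_isFirstCrossing h
    have h' : IsFirstCrossing x.exchange.walks i j v := by
      rw [h2]
      exact h.exchange
    obtain ⟨h3, h4⟩ := exchange_of_isFirstCrossing h'
    apply PermutedFamily.ext
    · rw [h3, h1, mul_assoc, Equiv.swap_mul_self, mul_one]
    · rw [h4, h2, h.exchangeFamily_exchangeFamily]
  · rw [exchange_of_not_hasCrossing h, exchange_of_not_hasCrossing h]

/-- The term of a permuted family in the expansion of the determinant. -/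
noncomputable def PermutedFamily.signedWeight {R : Type*} [CommRing R] (w : Quiver.Total V → R)
    (x : PermutedFamily a b) : R :=
  ((Equiv.Perm.sign x.perm : ℤ) : R) * ∏ i, walkWeight w (x.walks i).2

theorem PermutedFamily.signedWeight_exchange {R : Type*} [CommRing R] (w : Quiver.Total V → R)
    {x : PermutedFamily a b} (h : HasCrossing x.walks) :
    x.exchange.signedWeight w = -x.signedWeight w := by
  obtain ⟨i, j, v, h⟩ := h.exists_isFirstCrossing
  obtain ⟨h1, h2⟩ := exchange_of_isFirstCrossing h
  rw [signedWeight, h1, h2, h.prod_walkWeight_exchangeFamily, signedWeight,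
    Equiv.Perm.sign_mul, Equiv.Perm.sign_swap h.lt.ne]
  simp

/-! ### Families without crossings -/

/-- The hypothesis on the end vertices: walks whose end vertices are in the opposite order to their
start vertices meet. -/
def ForcesCrossing (a b : Fin k → V) : Prop :=
  ∀ i i' j j' : Fin k, i < i' → j' < j →
    ∀ (p : Quiver.Path (a i) (b j)) (q : Quiver.Path (a i') (b j')),
      ∃ v, v ∈ p.vertices ∧ v ∈ q.vertices

theorem ForcesCrossing.perm_eq_one (hab : ForcesCrossing a b) {x : PermutedFamily a b}
    (h : ¬ HasCrossing x.walks) : x.perm = 1 := by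
  have hmono : StrictMono x.perm := by
    intro i i' hi
    by_contra hσ
    have hlt : x.perm i' < x.perm i :=
      lt_of_le_of_ne (not_lt.1 hσ) fun e => hi.ne' (x.perm.injective e)
    obtain ⟨v, hv, hv'⟩ := hab i i' _ _ hi hlt
      ((x.walks i).2.loopErasure.cast rfl (x.end_eq i)) ((x.walks i').2.cast rfl (x.end_eq i'))
    rw [Quiver.Path.vertices_cast_right] at hv hv'
    exact h ⟨i, i', hi, v, hv, hv'⟩
  exact DFunLike.coe_injective ((hmono.range_inj strictMono_id).1 (by simp))

/-- A vertex common to `π j` and the loop-erased part of `π i`, with `i + 1 < j`, would allow a walk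
from `a i` to `b j` avoiding the loop-erased part of `π (i + 1)`; hence it suffices to look at
consecutive walks. -/
theorem ForcesCrossing.not_hasCrossing (hab : ForcesCrossing a b)
    (π : LoopErasedFamily a b) : ¬ HasCrossing fun i => ⟨b i, π.1 i⟩ := by
  suffices h : ∀ (n : ℕ) (i j : Fin k), (i : ℕ) + n + 1 = j →
      ∀ v ∈ (π.1 j).vertices, v ∉ (π.1 i).loopErasure.vertices by
    rintro ⟨i, j, hij, v, hv, hvj⟩
    exact h (j - i - 1) i j (by omega) v hvj hv
  intro n
  induction n with
  | zero => exact fun i j hij => π.2 i j hij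
  | succ n ih =>
    intro i j hij v hvj hvi
    obtain ⟨m, hm⟩ : ∃ m : Fin k, (m : ℕ) = i + 1 := ⟨⟨i + 1, by omega⟩, rfl⟩
    obtain ⟨p, p', hp⟩ := (π.1 i).loopErasure.exists_eq_comp_of_mem_vertices hvi
    obtain ⟨q, q', hq⟩ := (π.1 j).exists_eq_comp_of_mem_vertices hvj
    obtain ⟨u, hu, hum⟩ := hab i m j m (by omega) (by omega) (p.comp q') (π.1 m).loopErasure
    rcases (Quiver.Path.mem_vertices_comp _ _ _).1 hu with hu | hu
    · refine π.2 i m hm.symm u (Quiver.Path.loopErasure_vertices_subset _ hum) ?_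
      rw [hp]
      exact (Quiver.Path.mem_vertices_comp _ _ _).2 (Or.inl hu)
    · refine ih m j (by omega) u ?_ hum
      rw [hq]
      exact (Quiver.Path.mem_vertices_comp _ _ _).2 (Or.inr hu)

/-- A family of walks `a i → b i` as a permuted family, with the identity permutation. -/
def LoopErasedFamily.toPermutedFamily (π : LoopErasedFamily a b) : PermutedFamily a b where
  perm := 1
  walks i := ⟨b i, π.1 i⟩
  end_eq _ := rfl

theorem LoopErasedFamily.toPermutedFamily_injective :
    Function.Injective (LoopErasedFamily.toPermutedFamily (a := a) (b := b)) := by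
  intro π π' h
  apply Subtype.ext
  funext i
  have := congrFun (congrArg PermutedFamily.walks h) i
  simpa [toPermutedFamily] using this

theorem ForcesCrossing.range_toPermutedFamily (hab : ForcesCrossing a b) :
    Set.range (LoopErasedFamily.toPermutedFamily (a := a) (b := b)) =
      {x | ¬ HasCrossing x.walks} := by
  ext x
  refine ⟨?_, fun h => ?_⟩
  · rintro ⟨π, rfl⟩
    exact hab.not_hasCrossing π
  · have h1 := hab.perm_eq_one h
    have hx (i) : (x.walks i).1 = b i := by rw [x.end_eq, h1, Equiv.Perm.one_apply]
    refine ⟨⟨fun i => (x.walks i).2.cast rfl (hx i), fun i j hij v hvj hvi => ?_⟩, ?_⟩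
    · rw [Quiver.Path.loopErasure_cast_right, Quiver.Path.vertices_cast_right] at hvi
      rw [Quiver.Path.vertices_cast_right] at hvj
      exact h ⟨i, j, by omega, v, hvi, hvj⟩
    · refine PermutedFamily.ext h1.symm (funext fun i => ?_)
      exact Sigma.ext (hx i).symm (Quiver.Path.cast_heq rfl (hx i) (x.walks i).2)

end Crossing

/-! ### Products of sums and the expansion of the determinant -/

section Sums

universe u v

/-- A product of sums expands into a sum of products, for any notion `S f s` of "the family `f` has
sum `s`" that is multiplicative and invariant under reindexing. -/
theorem sums_pi_prod {R : Type v} [CommRing R] (S : ∀ {P : Type u}, (P → R) → R → Prop)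
    (hone : ∀ {P : Type u} [Unique P], S (fun _ : P => 1) 1)
    (hequiv : ∀ {P Q : Type u} (e : P ≃ Q) {f : Q → R} {s : R}, S (fun x => f (e x)) s → S f s)
    (hmul : ∀ {P Q : Type u} {f : P → R} {g : Q → R} {s t : R}, S f s → S g t →
      S (fun x : P × Q => f x.1 * g x.2) (s * t))
    {n : ℕ} {P : Fin n → Type u} {f : ∀ i, P i → R} {s : Fin n → R} (hf : ∀ i, S (f i) (s i)) :
    S (fun x : ∀ i, P i => ∏ i, f i (x i)) (∏ i, s i) := by
  induction n with
  | zero => simpa using hone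
  | succ n ih =>
    refine hequiv (Fin.consEquiv P) ?_
    simp only [Fin.prod_univ_succ, Fin.consEquiv_apply, Fin.cons_zero, Fin.cons_succ]
    exact hmul (hf 0) (ih fun i => hf i.succ)

theorem hasSum_prod_of_summable_norm {𝕜 : Type v} [RCLike 𝕜] {n : ℕ} {P : Fin n → Type u}
    {f : ∀ i, P i → 𝕜} (hf : ∀ i, Summable fun x => ‖f i x‖) :
    HasSum (fun x : ∀ i, P i => ∏ i, f i (x i)) (∏ i, ∑' x, f i x) := by
  refine (sums_pi_prod (fun {P} (f : P → 𝕜) s => Summable (fun x => ‖f x‖) ∧ HasSum f s)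
    ?_ ?_ ?_ fun i => ⟨hf i, (hf i).of_norm.hasSum⟩).2
  · intro P _
    exact ⟨(hasSum_unique _).summable, hasSum_unique _⟩
  · intro P Q e f s h
    exact ⟨e.summable_iff.1 h.1, e.hasSum_iff.1 h.2⟩
  · intro P Q f g s t hf hg
    exact ⟨hf.1.mul_norm hg.1, hf.2.mul hg.2 (summable_mul_of_summable_norm hf.1 hg.1)⟩

theorem hasSum_prod_of_nonarchimedean {R : Type v} [CommRing R] [UniformSpace R]
    [IsUniformAddGroup R] [NonarchimedeanRing R] {n : ℕ} {P : Fin n → Type u}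
    {f : ∀ i, P i → R} (hf : ∀ i, Summable (f i)) :
    HasSum (fun x : ∀ i, P i => ∏ i, f i (x i)) (∏ i, ∑' x, f i x) := by
  refine sums_pi_prod (fun {P} (f : P → R) s => HasSum f s) ?_ ?_ ?_ fun i => (hf i).hasSum
  · intro P _
    exact hasSum_unique _
  · intro P Q e f s h
    exact e.hasSum_iff.1 h
  · intro P Q f g s t hf hg
    exact hf.mul_of_nonarchimedean hg

variable {V : Type*} [Quiver V] {k : ℕ} {a b : Fin k → V} {R : Type*} [CommRing R]

/-- A family of walks `a i → b (σ i)` as a permuted family. -/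
def PermutedFamily.ofPaths (σ : Equiv.Perm (Fin k)) (π : ∀ i, Quiver.Path (a i) (b (σ i))) :
    PermutedFamily a b where
  perm := σ
  walks i := ⟨b (σ i), π i⟩
  end_eq _ := rfl

theorem PermutedFamily.ofPaths_injective (σ : Equiv.Perm (Fin k)) :
    Function.Injective (PermutedFamily.ofPaths (a := a) (b := b) σ) := by
  intro π π' h
  funext i
  have := congrFun (congrArg PermutedFamily.walks h) i
  simpa [ofPaths] using this

theorem PermutedFamily.exists_ofPaths_eq (x : PermutedFamily a b) : ∃ π, ofPaths x.perm π = x :=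
  ⟨fun i => (x.walks i).2.cast rfl (x.end_eq i), PermutedFamily.ext rfl (funext fun i =>
    Sigma.ext (x.end_eq i).symm (Quiver.Path.cast_heq rfl (x.end_eq i) (x.walks i).2))⟩

theorem hasSum_signedWeight [TopologicalSpace R] [IsTopologicalRing R] (w : Quiver.Total V → R)
    (hW : ∀ σ : Equiv.Perm (Fin k),
      HasSum (fun π : ∀ i, Quiver.Path (a i) (b (σ i)) => ∏ i, walkWeight w (π i))
        (∏ i, walkSum w (a i) (b (σ i)))) :
    HasSum (fun x : PermutedFamily a b => x.signedWeight w) (walkMatrix w a b).det := by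
  have hσ (σ : Equiv.Perm (Fin k)) :
      HasSum ({x : PermutedFamily a b | x.perm = σ}.indicator fun x => x.signedWeight w)
        (((Equiv.Perm.sign σ : ℤ) : R) * ∏ i, walkSum w (a i) (b (σ i))) := by
    refine ((PermutedFamily.ofPaths_injective σ).hasSum_iff fun x hx => ?_).1 ?_
    · refine Set.indicator_of_notMem (fun h => hx ?_) _
      obtain rfl : x.perm = σ := h
      exact x.exists_ofPaths_eq
    · refine ((hW σ).mul_left ((Equiv.Perm.sign σ : ℤ) : R)).congr_fun fun π => ?_
      exact Set.indicator_of_mem (a := PermutedFamily.ofPaths σ π)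
        (s := {x : PermutedFamily a b | x.perm = σ}) rfl _
  rw [← Matrix.det_transpose, Matrix.det_apply']
  convert hasSum_sum (s := Finset.univ) fun σ _ => hσ σ using 1
  · funext x
    classical
    simp [Set.indicator_apply]
  · rfl

/-- Families with a crossing cancel in pairs, hence the expansion of the determinant reduces to
families without crossings. -/
theorem hasSum_loopErasedFamily [UniformSpace R] [IsUniformAddGroup R] [CompleteSpace R]
    [T2Space R] [IsTopologicalRing R] [IsAddTorsionFree R] (hab : ForcesCrossing a b)
    (w : Quiver.Total V → R)
    (hW : ∀ σ : Equiv.Perm (Fin k),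
      HasSum (fun π : ∀ i, Quiver.Path (a i) (b (σ i)) => ∏ i, walkWeight w (π i))
        (∏ i, walkSum w (a i) (b (σ i)))) :
    HasSum (fun π : LoopErasedFamily a b => ∏ i, walkWeight w (π.1 i))
      (walkMatrix w a b).det := by
  have hdet := hasSum_signedWeight w hW
  set C : Set (PermutedFamily a b) := {x | HasCrossing x.walks}
  have hcross := (hdet.summable.indicator C).hasSum
  have hneg : (C.indicator fun x => x.signedWeight w) ∘ PermutedFamily.exchange =
      fun x => -C.indicator (fun x => x.signedWeight w) x := by
    funext x
    by_cases hx : HasCrossing x.walks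
    · have hx' : x.exchange ∈ C := x.hasCrossing_exchange_iff.2 hx
      rw [Function.comp_apply, Set.indicator_of_mem hx', Set.indicator_of_mem (s := C) hx,
        PermutedFamily.signedWeight_exchange w hx]
    · have hx' : x.exchange ∉ C := fun h => hx (x.hasCrossing_exchange_iff.1 h)
      rw [Function.comp_apply, Set.indicator_of_notMem hx', Set.indicator_of_notMem (s := C) hx,
        neg_zero]
  -- The exchange reindexes the sum over families with a crossing and changes its sign.
  have hzero : ∑' x, C.indicator (fun x => x.signedWeight w) x = 0 := by
    refine self_eq_neg.1 (HasSum.unique ?_ hcross.neg)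
    rw [← hneg]
    exact (PermutedFamily.exchange_involutive.toPerm _).hasSum_iff.2 hcross
  rw [hzero] at hcross
  have hsub := hdet.sub hcross
  rw [sub_zero] at hsub
  have hvanish : ∀ x ∉ Set.range (LoopErasedFamily.toPermutedFamily (a := a) (b := b)),
      x.signedWeight w - C.indicator (fun x => x.signedWeight w) x = 0 := by
    intro x hx
    rw [hab.range_toPermutedFamily] at hx
    rw [Set.indicator_of_mem (s := C) (not_not.1 hx), sub_self]
  refine ((LoopErasedFamily.toPermutedFamily_injective.hasSum_iff hvanish).2 hsub).congr_fun ?_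
  intro π
  have hπ : π.toPermutedFamily ∉ C := hab.not_hasCrossing π
  rw [Function.comp_apply, Set.indicator_of_notMem hπ, sub_zero]
  simp [PermutedFamily.signedWeight, LoopErasedFamily.toPermutedFamily]

end Sums

/-! ### Formal weights -/

section Formal

variable {V : Type*} [Quiver V]

/-- The list of edges of a walk. -/
def Quiver.Path.edgeList {a : V} : ∀ {b : V}, Quiver.Path a b → List (Quiver.Total V)
  | _, .nil => []
  | _, .cons p e => ⟨_, _, e⟩ :: p.edgeList

theorem Quiver.Path.edgeList_injective {a b : V} :
    Function.Injective (Quiver.Path.edgeList : Quiver.Path a b → List (Quiver.Total V)) := by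
  intro p q h
  induction p with
  | nil =>
    cases q with
    | nil => rfl
    | cons q e => simp [edgeList] at h
  | cons p e ih =>
    cases q with
    | nil => simp [edgeList] at h
    | cons q e' =>
      simp only [edgeList, List.cons.injEq, Quiver.Total.mk.injEq] at h
      obtain ⟨⟨rfl, -, he⟩, h⟩ := h
      rw [ih h, eq_of_heq he]

open Classical in
theorem walkWeight_formalWeight {a b : V} (p : Quiver.Path a b) :
    walkWeight (formalWeight V) p =
      MvPowerSeries.monomial (Multiset.toFinsupp (p.edgeList : Multiset (Quiver.Total V))) 1 := by
  induction p with
  | nil => simp [walkWeight, Quiver.Path.edgeList]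
  | cons p e ih =>
    rw [walkWeight, Quiver.Path.weight_cons, ← walkWeight, ih, formalWeight, MvPowerSeries.X_def,
      MvPowerSeries.monomial_mul_monomial, Quiver.Path.edgeList, ← Multiset.cons_coe,
      ← Multiset.singleton_add, map_add, Multiset.toFinsupp_singleton, add_comm, one_mul]

/-- Only finitely many walks have a given monomial as their weight, since a walk is determined by
the order in which it uses its edges. -/
theorem summable_walkWeight_formalWeight (a b : V) :
    Summable fun p : Quiver.Path a b => walkWeight (formalWeight V) p := by
  classical
  rw [MvPowerSeries.WithPiTopology.summable_iff_summable_coeff]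
  intro d
  refine summable_of_hasFiniteSupport (Set.Finite.subset (Set.Finite.preimage
    Quiver.Path.edgeList_injective.injOn (List.finite_toSet d.toMultiset.toList.permutations)) ?_)
  intro p hp
  rw [Function.mem_support, walkWeight_formalWeight, MvPowerSeries.coeff_monomial] at hp
  have hd : d = Multiset.toFinsupp (p.edgeList : Multiset (Quiver.Total V)) := by
    by_contra h
    simp [h] at hp
  rw [Set.mem_preimage, Set.mem_ofPred_eq, List.mem_permutations, ← Multiset.coe_eq_coe,
    Multiset.coe_toList, hd, Multiset.toFinsupp_toMultiset]

/-- The submodules form a basis of neighbourhoods of `0`. -/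
instance MvPowerSeries.nonarchimedeanRing_int (σ : Type*) :
    NonarchimedeanRing (MvPowerSeries σ ℤ) where
  is_nonarchimedean U hU := by
    obtain ⟨N, hN, hNU⟩ := (IsLinearTopology.hasBasis_open_submodule
      (MvPowerSeries σ ℤ) (M := MvPowerSeries σ ℤ)).mem_iff.1 hU
    exact ⟨⟨N.toAddSubgroup, hN⟩, hNU⟩

instance MvPowerSeries.isAddTorsionFree_int (σ : Type*) : IsAddTorsionFree (MvPowerSeries σ ℤ) :=
  inferInstanceAs (IsAddTorsionFree ((σ →₀ ℕ) → ℤ))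

end Formal

/-! ### The determinant and the minors of the walk matrix -/

theorem mainTheorem2 {V : Type*} [Quiver V] {𝕜 : Type*} [RCLike 𝕜] {k : ℕ} (a b : Fin k → V)
    (hab : ∀ i i' j j' : Fin k, i < i' → j' < j →
      ∀ (p : Quiver.Path (a i) (b j)) (q : Quiver.Path (a i') (b j')),
        ∃ v, v ∈ p.vertices ∧ v ∈ q.vertices) :
    -- the identity for formal weights
    ((∀ i j, Summable fun p : Quiver.Path (a i) (b j) => walkWeight (formalWeight V) p) ∧
      HasSum (fun π : LoopErasedFamily a b => ∏ i, walkWeight (formalWeight V) (π.1 i))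
        (walkMatrix (formalWeight V) a b).det) ∧
    -- the identity for numerical weights, when the series for the entries converge absolutely
    (∀ w : Quiver.Total V → 𝕜,
      (∀ i j, Summable fun p : Quiver.Path (a i) (b j) => ‖walkWeight w p‖) →
        HasSum (fun π : LoopErasedFamily a b => ∏ i, walkWeight w (π.1 i))
          (walkMatrix w a b).det) ∧
    -- total nonnegativity for nonnegative weights
    (∀ w : Quiver.Total V → ℝ, (∀ e, 0 ≤ w e) →
      (∀ i j, Summable fun p : Quiver.Path (a i) (b j) => walkWeight w p) →
        (walkMatrix w a b).IsTotallyNonneg) := by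
  refine ⟨⟨fun i j => summable_walkWeight_formalWeight _ _, ?_⟩, fun w hw => ?_,
    fun w hw hs r I J => ?_⟩
  · exact hasSum_loopErasedFamily hab _ fun σ =>
      hasSum_prod_of_nonarchimedean fun i => summable_walkWeight_formalWeight _ _
  · exact hasSum_loopErasedFamily hab w fun σ => hasSum_prod_of_summable_norm fun i => hw _ _
  · have hnonneg {x y : V} (p : Quiver.Path x y) : 0 ≤ walkWeight w p :=
      Quiver.Path.weight_nonneg (fun e => hw _) p
    -- A minor is the determinant for subfamilies of the given vertices.
    have hIJ : ForcesCrossing (a ∘ I) (b ∘ J) := fun i i' j j' hi hj =>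
      hab (I i) (I i') (J j) (J j') (I.strictMono hi) (J.strictMono hj)
    have h : HasSum _ (walkMatrix w (a ∘ I) (b ∘ J)).det :=
      hasSum_loopErasedFamily hIJ w fun σ => hasSum_prod_of_summable_norm fun i =>
        (hs (I i) (J (σ i))).norm
    exact h.nonneg fun π => Finset.prod_nonneg fun i _ => hnonneg _
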